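/- Let $(M,g)$ and $(N,g_N)$ be smooth finite-dimensional Riemannian manifolds (without boundary), $\dim M>\dim N$, and let $(\varphi,\xi,\eta,g)$ be a Sasakian structure on $M$. That is, $\varphi$ is a smooth $(1,1)$-tensor field, $\xi$ a smooth vector field (the Reeb field) and $\eta$ a smooth 1-form with $$\varphi\xi=0,\quad \eta(\xi)=1,\quad \varphi^2=-I+\eta\otimes\xi,\quad g(\varphi X,\varphi Y)=g(X,Y)-\eta(X)\eta(Y),$$ which is contact, $g(X,\varphi Y)=d\eta(X,Y)$, and normal, $[\varphi,\varphi]+2\,d\eta\otimes\xi=0$, where $d\eta(X,Y)=\tfrac12\big(X\eta(Y)-Y\eta(X)-\eta([X,Y])\big)$ and $[\varphi,\varphi](X,Y)=\varphi^2[X,Y]+[\varphi X,\varphi Y]-\varphi[\varphi X,Y]-\varphi[X,\varphi Y]$. Let $\pi:M\to N$ be a Riemannian submersion, i.e. a smooth surjective map whose differential $\pi_*$ has rank $\dim N$ everywhere and satisfies $g_N(\pi_*Y,\pi_*Z)=g(Y,Z)$ for all horizontal vectors $Y,Z\in(\ker\pi_*)^\perp$ at the same point. Suppose that $\pi$ is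 anti-invariant, $\varphi(\ker\pi_*)\subseteq(\ker\pi_*)^\perp$, and that the Reeb field is horizontal, $\xi\in(\ker\pi_*)^\perp$. Let $f:M\to\mathbb R$ be differentiable and suppose that $\pi$ is a Clairaut submersion with $r=e^f$: for every geodesic $\alpha$ of $(M,g)$ with nonzero velocity, defined on an open interval, the function $t\mapsto e^{f(\alpha(t))}\sin\theta(t)$ is constant, where $\theta(t)$ is the angle between $\dot\alpha(t)$ and the horizontal space at $\alpha(t)$. Then $$g(\nabla f,\xi)=0$$ everywhere on $M$, where $\nabla f$ is the gradient of $f$ with respect to $g$. -/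

import Mathlib

open Bundle Set
open scoped Manifold ContDiff Topology

noncomputable section

namespace ClairautSubmersion

/-! Throughout, `M` is a smooth manifold without boundary modelled on the finite-dimensional real
vector space `E`, and `N` one modelled on `E'`. A Riemannian metric on `M` is given by the
instances `RiemannianBundle` (an inner product on every tangent space) and
`IsContMDiffRiemannianBundle` with exponent `∞` (it depends smoothly on the point). -/

section Setting

variable {E : Type*} [NormedAddCommGroup E] [NormedSpace ℝ E]
  {M : Type*} [TopologicalSpace M] [ChartedSpace E M] [IsManifold 𝓘(ℝ, E) ∞ M]

instance instFiniteDimensionalTangentSpace [FiniteDimensional ℝ E] (p : M) :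
    FiniteDimensional ℝ (TangentSpace 𝓘(ℝ, E) p) :=
  inferInstanceAs (FiniteDimensional ℝ E)

/-- A (not necessarily continuous) vector field on `M`. -/
abbrev VField (E : Type*) [NormedAddCommGroup E] [NormedSpace ℝ E]
    (M : Type*) [TopologicalSpace M] [ChartedSpace E M] : Type _ :=
  Π p : M, TangentSpace 𝓘(ℝ, E) p

/-- The vector field `X` is smooth on a neighbourhood of `p`. -/
def SmoothFieldAt (X : VField E M) (p : M) : Prop :=
  ContMDiffAt 𝓘(ℝ, E) 𝓘(ℝ, E).tangent ∞ (fun q ↦ (TotalSpace.mk' E q (X q) : TangentBundle 𝓘(ℝ, E) M)) p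

/-- The differential `df_p` of a real function, as a linear functional on `T_p M`. -/
def differential (f : M → ℝ) (p : M) : TangentSpace 𝓘(ℝ, E) p →L[ℝ] ℝ :=
  mfderiv 𝓘(ℝ, E) 𝓘(ℝ, ℝ) f p

/-- The exterior derivative of a 1-form evaluated on vector fields, with the normalisation
`dη(X, Y) = ½ (X(η(Y)) - Y(η(X)) - η([X, Y]))`. -/
def dOneForm (η : Π p : M, TangentSpace 𝓘(ℝ, E) p →L[ℝ] ℝ) (X Y : VField E M) (p : M) : ℝ :=
  (1 / 2 : ℝ) * (differential (fun q ↦ η q (Y q)) p (X p)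
    - differential (fun q ↦ η q (X q)) p (Y p)
    - η p (VectorField.mlieBracket 𝓘(ℝ, E) X Y p))

/-- The Nijenhuis tensor of a field `φ` of endomorphisms,
`[φ, φ](X, Y) = φ²[X, Y] + [φX, φY] - φ[φX, Y] - φ[X, φY]`. -/
def nijenhuis (φ : Π p : M, TangentSpace 𝓘(ℝ, E) p →L[ℝ] TangentSpace 𝓘(ℝ, E) p)
    (X Y : VField E M) (p : M) : TangentSpace 𝓘(ℝ, E) p :=
  φ p (φ p (VectorField.mlieBracket 𝓘(ℝ, E) X Y p))
    + VectorField.mlieBracket 𝓘(ℝ, E) (fun q ↦ φ q (X q)) (fun q ↦ φ q (Y q)) p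
    - φ p (VectorField.mlieBracket 𝓘(ℝ, E) (fun q ↦ φ q (X q)) Y p)
    - φ p (VectorField.mlieBracket 𝓘(ℝ, E) X (fun q ↦ φ q (Y q)) p)

end Setting

section Riemannian

variable {E : Type*} [NormedAddCommGroup E] [NormedSpace ℝ E] [FiniteDimensional ℝ E]
  {M : Type*} [TopologicalSpace M] [ChartedSpace E M] [IsManifold 𝓘(ℝ, E) ∞ M]
  [RiemannianBundle (fun p : M ↦ TangentSpace 𝓘(ℝ, E) p)]
  {E' : Type*} [NormedAddCommGroup E'] [NormedSpace ℝ E'] [FiniteDimensional ℝ E']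
  {N : Type*} [TopologicalSpace N] [ChartedSpace E' N] [IsManifold 𝓘(ℝ, E') ∞ N]
  [RiemannianBundle (fun q : N ↦ TangentSpace 𝓘(ℝ, E') q)]

/-- The gradient of a function: `g(∇f, v) = df(v)` for all `v ∈ T_p M`. -/
def riemannianGradient (f : M → ℝ) (p : M) : TangentSpace 𝓘(ℝ, E) p :=
  haveI : CompleteSpace (TangentSpace 𝓘(ℝ, E) p) := FiniteDimensional.complete ℝ _
  (InnerProductSpace.toDual ℝ (TangentSpace 𝓘(ℝ, E) p)).symm (differential f p)

/-- The components `g(∂_a, ∂_b)` of the metric in the chart of `M` at `x₀`, at the point with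
coordinates `u`; here `∂_a` is the coordinate vector field belonging to `a ∈ E`. -/
def chartMetric (x₀ : M) (u a b : E) : ℝ :=
  let p : M := (extChartAt 𝓘(ℝ, E) x₀).symm u
  let D : E →L[ℝ] TangentSpace 𝓘(ℝ, E) p :=
    mfderiv 𝓘(ℝ, E) 𝓘(ℝ, E) (extChartAt 𝓘(ℝ, E) x₀).symm u
  inner ℝ (D a) (D b)

/-- The Christoffel symbols (of the first kind) of the Levi-Civita connection in the chart at `x₀`:
`g(∇_{∂_a} ∂_b, ∂_w) = ½ (∂_a g(∂_b, ∂_w) + ∂_b g(∂_a, ∂_w) - ∂_w g(∂_a, ∂_b))`. -/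
def christoffel (x₀ : M) (u a b w : E) : ℝ :=
  (1 / 2 : ℝ) * (fderiv ℝ (fun u' ↦ chartMetric x₀ u' b w) u a
    + fderiv ℝ (fun u' ↦ chartMetric x₀ u' a w) u b
    - fderiv ℝ (fun u' ↦ chartMetric x₀ u' a b) u w)

/-- The curve `α` read in the chart of `M` at `x₀`. -/
def chartCurve (x₀ : M) (α : ℝ → M) (t : ℝ) : E := extChartAt 𝓘(ℝ, E) x₀ (α t)

/-- `g(∇_{α'} α', ∂_w)` at time `t`, computed in the chart at `x₀`: if `c` is `α` in coordinates,
then it is `g(c'', ∂_w) + g(∇_{c'} c', ∂_w)`, the second term being formed with `c'` frozen. -/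
def chartAcceleration (x₀ : M) (α : ℝ → M) (t : ℝ) (w : E) : ℝ :=
  let c : ℝ → E := chartCurve x₀ α
  chartMetric x₀ (c t) (deriv (deriv c) t) w + christoffel x₀ (c t) (deriv c t) (deriv c t) w

/-- `α` is a geodesic on the open set `s` of parameters: it is continuous there, and near every
time `t ∈ s` it is twice continuously differentiable with `∇_{α'} α' = 0` at `t`, as expressed in
a chart around `α t` (the condition does not depend on the chart). -/
def IsGeodesicOn (α : ℝ → M) (s : Set ℝ) : Prop :=
  ContinuousOn α s ∧
  ∀ t ∈ s, ∃ x₀ : M, α t ∈ (extChartAt 𝓘(ℝ, E) x₀).source ∧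
    ContDiffAt ℝ 2 (chartCurve (E := E) x₀ α) t ∧
    ∀ w : E, chartAcceleration x₀ α t w = 0

/-- The velocity vector `α'(t)`. -/
def velocity (α : ℝ → M) (t : ℝ) : TangentSpace 𝓘(ℝ, E) (α t) :=
  mfderiv 𝓘(ℝ, ℝ) 𝓘(ℝ, E) α t (1 : ℝ)

/-- The vertical space `ker pr_*` at `p`. -/
def vertical (E : Type*) [NormedAddCommGroup E] [NormedSpace ℝ E]
    {M : Type*} [TopologicalSpace M] [ChartedSpace E M]
    (E' : Type*) [NormedAddCommGroup E'] [NormedSpace ℝ E']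
    {N : Type*} [TopologicalSpace N] [ChartedSpace E' N]
    (pr : M → N) (p : M) : Submodule ℝ (TangentSpace 𝓘(ℝ, E) p) :=
  LinearMap.ker (mfderiv 𝓘(ℝ, E) 𝓘(ℝ, E') pr p).toLinearMap

/-- The horizontal space `(ker pr_*)ᗮ` at `p`. -/
def horizontal (E : Type*) [NormedAddCommGroup E] [NormedSpace ℝ E]
    {M : Type*} [TopologicalSpace M] [ChartedSpace E M]
    [RiemannianBundle (fun p : M ↦ TangentSpace 𝓘(ℝ, E) p)]
    (E' : Type*) [NormedAddCommGroup E'] [NormedSpace ℝ E']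
    {N : Type*} [TopologicalSpace N] [ChartedSpace E' N]
    (pr : M → N) (p : M) : Submodule ℝ (TangentSpace 𝓘(ℝ, E) p) :=
  (vertical E E' pr p)ᗮ

variable (E E') in
/-- `pr : M → N` is a Riemannian submersion: `dim M > dim N`, and `pr` is smooth, surjective, of
rank `dim N` everywhere, and `pr_*` preserves the inner products of horizontal vectors. -/
structure IsRiemannianSubmersion (pr : M → N) : Prop where
  finrank_lt : Module.finrank ℝ E' < Module.finrank ℝ E
  smooth : ContMDiff 𝓘(ℝ, E) 𝓘(ℝ, E') ∞ pr
  surjective : Function.Surjective pr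
  surjective_mfderiv : ∀ p : M, Function.Surjective (mfderiv 𝓘(ℝ, E) 𝓘(ℝ, E') pr p)
  isometric : ∀ p : M, ∀ Y ∈ horizontal E E' pr p, ∀ Z ∈ horizontal E E' pr p,
    inner ℝ (mfderiv 𝓘(ℝ, E) 𝓘(ℝ, E') pr p Y) (mfderiv 𝓘(ℝ, E) 𝓘(ℝ, E') pr p Z) = inner ℝ Y Z

variable (E E') in
/-- The angle between a tangent vector and the horizontal space, i.e. the angle between the vector
and its orthogonal projection to the horizontal space (a right angle if this projection is `0`). -/
def horizontalAngle (pr : M → N) (p : M) (v : TangentSpace 𝓘(ℝ, E) p) : ℝ :=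
  InnerProductGeometry.angle v ((horizontal E E' pr p).starProjection v)

variable (E E') in
/-- The Clairaut condition with the function `r`: `r` is positive and `(r ∘ α) sin θ` is constant
along every (regular) geodesic `α`, defined on any open interval `s`, where `θ(t)` is the angle
between `α'(t)` and the horizontal space at `α(t)`. -/
def IsClairautWith (pr : M → N) (r : M → ℝ) : Prop :=
  (∀ p : M, 0 < r p) ∧
  ∀ (α : ℝ → M) (s : Set ℝ), IsOpen s → s.OrdConnected → IsGeodesicOn (E := E) α s →
    (∀ t ∈ s, velocity (E := E) α t ≠ 0) →
    ∃ C : ℝ, ∀ t ∈ s, r (α t) * Real.sin (horizontalAngle E E' pr (α t) (velocity α t)) = C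

variable (E M) in
/-- An almost contact metric structure `(φ, ξ, η, g)` on the Riemannian manifold `(M, g)`. -/
structure AlmostContactMetricStructure where
  /-- the tensor field of type `(1,1)` -/
  φ : Π p : M, TangentSpace 𝓘(ℝ, E) p →L[ℝ] TangentSpace 𝓘(ℝ, E) p
  /-- the Reeb vector field -/
  ξ : Π p : M, TangentSpace 𝓘(ℝ, E) p
  /-- the 1-form dual to the Reeb vector field -/
  η : Π p : M, TangentSpace 𝓘(ℝ, E) p →L[ℝ] ℝ
  smooth_φ : ContMDiff 𝓘(ℝ, E) (𝓘(ℝ, E).prod 𝓘(ℝ, E →L[ℝ] E)) ∞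
    (fun p ↦ TotalSpace.mk' (E →L[ℝ] E)
      (E := fun p : M ↦ TangentSpace 𝓘(ℝ, E) p →L[ℝ] TangentSpace 𝓘(ℝ, E) p) p (φ p))
  smooth_ξ : ContMDiff 𝓘(ℝ, E) 𝓘(ℝ, E).tangent ∞
    (fun p ↦ (TotalSpace.mk' E p (ξ p) : TangentBundle 𝓘(ℝ, E) M))
  smooth_η : ContMDiff 𝓘(ℝ, E) (𝓘(ℝ, E).prod 𝓘(ℝ, E →L[ℝ] ℝ)) ∞
    (fun p ↦ TotalSpace.mk' (E →L[ℝ] ℝ)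
      (E := fun p : M ↦ TangentSpace 𝓘(ℝ, E) p →L[ℝ] Bundle.Trivial M ℝ p) p (η p))
  φ_ξ : ∀ p, φ p (ξ p) = 0
  η_ξ : ∀ p, η p (ξ p) = 1
  φ_φ : ∀ p v, φ p (φ p v) = -v + η p v • ξ p
  inner_φ_φ : ∀ p v w, (inner ℝ (φ p v) (φ p w) : ℝ) = inner ℝ v w - η p v * η p w

/-- Contact metric structure: the fundamental 2-form `Φ(X, Y) = g(X, φY)` equals `dη`. -/
def AlmostContactMetricStructure.IsContact (S : AlmostContactMetricStructure E M) : Prop :=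
  ∀ (X Y : VField E M) (p : M), SmoothFieldAt X p → SmoothFieldAt Y p →
    inner ℝ (X p) (S.φ p (Y p)) = dOneForm S.η X Y p

/-- Normality: `[φ, φ] + 2 dη ⊗ ξ = 0`. -/
def AlmostContactMetricStructure.IsNormal (S : AlmostContactMetricStructure E M) : Prop :=
  ∀ (X Y : VField E M) (p : M), SmoothFieldAt X p → SmoothFieldAt Y p →
    nijenhuis S.φ X Y p + (2 * dOneForm S.η X Y p) • S.ξ p = 0

/-- A Sasakian structure is a normal contact metric structure. -/
structure AlmostContactMetricStructure.IsSasakian (S : AlmostContactMetricStructure E M) :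
    Prop where
  contact : S.IsContact
  normal : S.IsNormal

/-- `pr` is anti-invariant: `φ (ker pr_*) ⊆ (ker pr_*)ᗮ`. -/
def AlmostContactMetricStructure.IsAntiInvariant (E' : Type*) [NormedAddCommGroup E']
    [NormedSpace ℝ E'] {N : Type*} [TopologicalSpace N] [ChartedSpace E' N]
    (S : AlmostContactMetricStructure E M) (pr : M → N) : Prop :=
  ∀ p : M, ∀ v ∈ vertical E E' pr p, S.φ p v ∈ horizontal E E' pr p

/-- The Reeb vector field of the structure is horizontal. -/
def AlmostContactMetricStructure.HasHorizontalReeb (E' : Type*) [NormedAddCommGroup E']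
    [NormedSpace ℝ E'] {N : Type*} [TopologicalSpace N] [ChartedSpace E' N]
    (S : AlmostContactMetricStructure E M) (pr : M → N) : Prop :=
  ∀ p : M, S.ξ p ∈ horizontal E E' pr p

end Riemannian

end ClairautSubmersion

end

open ClairautSubmersion

/-! Write `G` for the metric of `M` in a chart and `K` for the pullback of the metric of `N`, a
semidefinite form with kernel the vertical space. Since `|u|² sin² θ = (G - K)(u, u)`, squaring
Clairaut's relation gives `e^{2f} (G - K)(c', c') = C² G(c', c')` along a geodesic `c`. The speed is
constant, so differentiating yields `2 df(c') (G - K)(c', c') = (K(c', c'))'`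
(`clairaut_derivative`). Geodesics with any initial data exist locally, so this holds for every
nonzero initial velocity `u` at a point (`IsClairautWith.chart`).

Let `v ≠ 0` be vertical; one exists because `dim M > dim N`. Put `u = v ± ξ` and take half the
difference. As `ξ` is horizontal, `K(·, ξ) = G(·, ξ)`, and the result collapses to `2 df(ξ) G(v, v)
= (L_ξ G)(v, v)` (`clairaut_polarized`). In a Sasakian structure `ξ` is Killing (`reeb_killing`):
`L_ξ` annihilates `dη` and, by normality, `φ`, hence also `G(·, φ·) = dη`. The right side is
therefore zero, while `G(v, v) ≠ 0`. -/

noncomputable section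

namespace ClairautSubmersion

set_option maxSynthPendingDepth 3
set_option linter.unusedSectionVars false

/-! ### Second order differential equations on a vector space -/

section Calculus

variable {E : Type*} [NormedAddCommGroup E] [NormedSpace ℝ E]

/-- Local existence for second order autonomous equations `c'' = Z (c, c')`, with the solution
staying in a prescribed neighbourhood of the initial data. -/
theorem exists_solution_second_order [CompleteSpace E] {Z : E × E → E} {x v : E}
    (hZ : ContDiffAt ℝ 1 Z (x, v)) {P : E × E → Prop} (hP : ∀ᶠ z in 𝓝 (x, v), P z) :
    ∃ c : ℝ → E, ∃ ε > (0 : ℝ), c 0 = x ∧ deriv c 0 = v ∧ ∀ t ∈ Ioo (-ε) ε,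
      P (c t, deriv c t) ∧ ContDiffAt ℝ 2 c t ∧ deriv (deriv c) t = Z (c t, deriv c t) := by
  -- Picard–Lindelöf for the first order system `(c, d)' = (d, Z (c, d))`.
  have hY : ContDiffAt ℝ 1 (fun z : E × E ↦ (z.2, Z z)) (x, v) := contDiffAt_snd.prodMk hZ
  obtain ⟨α, hα0, ε, hε, hα⟩ :=
    hY.exists_forall_mem_closedBall_exists_eq_forall_mem_Ioo_hasDerivAt₀ 0
  simp only [zero_sub, zero_add] at hα
  have hα0c : ContinuousAt α 0 := (hα 0 ⟨by linarith, hε⟩).continuousAt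
  -- Being `C¹` at a point is an open condition; keeping it along the solution makes `Z ∘ α`, hence
  -- `c''`, continuous, which gives `c` of class `C²`.
  have hev : ∀ᶠ z in 𝓝 (α 0), P z ∧ ContDiffAt ℝ 1 Z z := by
    rw [hα0]; exact hP.and (hZ.eventually (by simp))
  obtain ⟨δ, hδ, hδP⟩ := Metric.eventually_nhds_iff.1 (hα0c.eventually hev)
  set r := min ε δ with hr
  have hr0 : 0 < r := lt_min hε hδ
  have hin : ∀ t ∈ Ioo (-r) r, t ∈ Ioo (-ε) ε ∧ P (α t) ∧ ContDiffAt ℝ 1 Z (α t) := by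
    intro t ht
    have h1 : r ≤ ε := min_le_left _ _
    have h2 : r ≤ δ := min_le_right _ _
    refine ⟨⟨by linarith [ht.1], by linarith [ht.2]⟩, hδP ?_⟩
    rw [Real.dist_eq, sub_zero]
    exact lt_of_lt_of_le (abs_lt.2 ht) h2
  set c : ℝ → E := fun t ↦ (α t).1 with hc
  have hc1 : ∀ t ∈ Ioo (-r) r, HasDerivAt c (α t).2 t := fun t ht ↦ by
    have := (hα t (hin t ht).1).hasFDerivAt.fst.hasDerivAt
    simpa using this
  have hd1 : ∀ t ∈ Ioo (-r) r, HasDerivAt (fun t ↦ (α t).2) (Z (α t)) t := fun t ht ↦ by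
    have := (hα t (hin t ht).1).hasFDerivAt.snd.hasDerivAt
    simpa using this
  have hdc : EqOn (deriv c) (fun t ↦ (α t).2) (Ioo (-r) r) := fun t ht ↦ (hc1 t ht).deriv
  have hpair : ∀ t ∈ Ioo (-r) r, (c t, deriv c t) = α t := fun t ht ↦ by rw [hdc ht]
  have hd2 : ∀ t ∈ Ioo (-r) r, HasDerivAt (deriv c) (Z (α t)) t := fun t ht ↦
    (hd1 t ht).congr_of_eventuallyEq
      (Filter.eventuallyEq_of_mem (isOpen_Ioo.mem_nhds ht) hdc)
  have hcont : ContinuousOn (deriv (deriv c)) (Ioo (-r) r) := by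
    have : ContinuousOn (fun t ↦ Z (α t)) (Ioo (-r) r) := fun t ht ↦
      ((hin t ht).2.2.continuousAt.comp (hα t (hin t ht).1).continuousAt).continuousWithinAt
    exact this.congr fun t ht ↦ (hd2 t ht).deriv
  have hC1 : ContDiffOn ℝ 1 (deriv c) (Ioo (-r) r) := by
    rw [show (1 : ℕ∞ω) = 0 + 1 by simp, contDiffOn_succ_iff_deriv_of_isOpen isOpen_Ioo]
    exact ⟨fun t ht ↦ (hd2 t ht).differentiableAt.differentiableWithinAt, by simp,
      contDiffOn_zero.2 hcont⟩
  have hC2 : ContDiffOn ℝ 2 c (Ioo (-r) r) := by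
    rw [show (2 : ℕ∞ω) = 1 + 1 by norm_num, contDiffOn_succ_iff_deriv_of_isOpen isOpen_Ioo]
    exact ⟨fun t ht ↦ (hc1 t ht).differentiableAt.differentiableWithinAt, by simp, hC1⟩
  have h0 : (0 : ℝ) ∈ Ioo (-r) r := ⟨by linarith, hr0⟩
  refine ⟨c, r, hr0, by simp [hc, hα0], by rw [hdc h0]; simp [hα0], fun t ht ↦ ?_⟩
  rw [hpair t ht]
  exact ⟨(hin t ht).2.1, hC2.contDiffAt (isOpen_Ioo.mem_nhds ht), (hd2 t ht).deriv⟩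

/-! ### The geodesic equation of a variable bilinear form -/

/-- The functional `w ↦ g(∇_{∂_a} ∂_a, ∂_w)` for a metric `G` on a vector space. -/
def geodesicForce (G : E → E →L[ℝ] E →L[ℝ] ℝ) (z : E × E) : E →L[ℝ] ℝ :=
  fderiv ℝ G z.1 z.2 z.2 - (1 / 2 : ℝ) • ((fderiv ℝ G z.1).flip z.2).flip z.2

theorem geodesicForce_apply (G : E → E →L[ℝ] E →L[ℝ] ℝ) (z : E × E) (w : E) :
    geodesicForce G z w
      = fderiv ℝ G z.1 z.2 z.2 w - (1 / 2 : ℝ) * fderiv ℝ G z.1 w z.2 z.2 := by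
  simp [geodesicForce]

theorem contDiffAt_geodesicForce {G : E → E →L[ℝ] E →L[ℝ] ℝ} {z : E × E}
    (hG : ContDiffAt ℝ 2 G z.1) : ContDiffAt ℝ 1 (geodesicForce G) z := by
  have h1 : ContDiffAt ℝ 1 (fun z : E × E ↦ fderiv ℝ G z.1) z :=
    (hG.fderiv_right (m := 1) (by norm_num)).comp z contDiffAt_fst
  have h2 : ContDiffAt ℝ 1 (fun z : E × E ↦ z.2) z := contDiffAt_snd
  have h3 : ContDiffAt ℝ 1 (fun z : E × E ↦ (fderiv ℝ G z.1).flip) z :=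
    (ContinuousLinearMap.flipₗᵢ ℝ E E (E →L[ℝ] ℝ)).contDiff.contDiffAt.comp z h1
  have h4 : ContDiffAt ℝ 1 (fun z : E × E ↦ ((fderiv ℝ G z.1).flip z.2).flip) z :=
    (ContinuousLinearMap.flipₗᵢ ℝ E E ℝ).contDiff.contDiffAt.comp z (h3.clm_apply h2)
  exact ((h1.clm_apply h2).clm_apply h2).sub ((h4.clm_apply h2).const_smul (1 / 2 : ℝ))

/-- The acceleration of a geodesic of `G` with given position and velocity. -/
def geodesicSpray (G : E → E →L[ℝ] E →L[ℝ] ℝ) (z : E × E) : E :=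
  -(G z.1).inverse (geodesicForce G z)

/-- The force uses one derivative of `G`, so `G` of class `C²` leaves the `C¹` regularity that the
local existence theorem needs. -/
theorem contDiffAt_geodesicSpray [CompleteSpace E] {G : E → E →L[ℝ] E →L[ℝ] ℝ} {z : E × E}
    (hG : ContDiffAt ℝ 2 G z.1) (hinv : (G z.1).IsInvertible) :
    ContDiffAt ℝ 1 (geodesicSpray G) z := by
  have h1 : ContDiffAt ℝ 1 (fun z : E × E ↦ (G z.1).inverse) z :=
    hinv.contDiffAt_map_inverse.comp z ((hG.of_le (by norm_num)).comp z contDiffAt_fst)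
  exact (h1.clm_apply (contDiffAt_geodesicForce hG)).neg

theorem apply_geodesicSpray {G : E → E →L[ℝ] E →L[ℝ] ℝ} {z : E × E}
    (hinv : (G z.1).IsInvertible) (w : E) :
    G z.1 (geodesicSpray G z) w = -geodesicForce G z w := by
  simp [geodesicSpray, hinv.self_apply_inverse]

/-! ### The infinitesimal Clairaut relation and its polarisation -/

/-- The derivative of a symmetric bilinear form evaluated on the velocity of a curve. -/
theorem hasDerivAt_bilin_velocity {K : E → E →L[ℝ] E →L[ℝ] ℝ} {c : ℝ → E}
    (hK : DifferentiableAt ℝ K (c 0)) (hsymm : ∀ a b, K (c 0) a b = K (c 0) b a)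
    (hc : ContDiffAt ℝ 2 c 0) :
    HasDerivAt (fun t ↦ K (c t) (deriv c t) (deriv c t))
      (fderiv ℝ K (c 0) (deriv c 0) (deriv c 0) (deriv c 0)
        + 2 * K (c 0) (deriv (deriv c) 0) (deriv c 0)) 0 := by
  have h1 : HasDerivAt c (deriv c 0) 0 := (hc.differentiableAt (by norm_num)).hasDerivAt
  have h2 : HasDerivAt (deriv c) (deriv (deriv c) 0) 0 :=
    (((hc.fderiv_right (m := 1) (by norm_num)).clm_apply
      (contDiffAt_const (c := (1 : ℝ)))).differentiableAt (by norm_num)).hasDerivAt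
  have h3 : HasDerivAt (fun t ↦ K (c t)) (fderiv ℝ K (c 0) (deriv c 0)) 0 :=
    hK.hasFDerivAt.comp_hasDerivAt 0 h1
  have h4 := (h3.clm_apply h2).clm_apply h2
  refine h4.congr_deriv ?_
  simp only [add_apply]
  rw [hsymm (deriv c 0) (deriv (deriv c) 0)]
  ring

/-- The infinitesimal form of Clairaut's relation: if `e^{2F} (G - K)(c', c') / G(c', c')` is
constant along a geodesic `c` of `G`, then its derivative vanishes. -/
theorem clairaut_derivative {G K : E → E →L[ℝ] E →L[ℝ] ℝ} {F : E → ℝ} {c : ℝ → E}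
    (hG : DifferentiableAt ℝ G (c 0)) (hK : DifferentiableAt ℝ K (c 0))
    (hF : DifferentiableAt ℝ F (c 0)) (hGsymm : ∀ a b, G (c 0) a b = G (c 0) b a)
    (hKsymm : ∀ a b, K (c 0) a b = K (c 0) b a) (hc : ContDiffAt ℝ 2 c 0)
    (hgeo : ∀ w, G (c 0) (deriv (deriv c) 0) w = -geodesicForce G (c 0, deriv c 0) w) {C : ℝ}
    (hC : ∀ᶠ t in 𝓝 (0 : ℝ), Real.exp (F (c t)) ^ 2 *
      (G (c t) (deriv c t) (deriv c t) - K (c t) (deriv c t) (deriv c t))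
        = C * G (c t) (deriv c t) (deriv c t)) :
    2 * fderiv ℝ F (c 0) (deriv c 0) *
      (G (c 0) (deriv c 0) (deriv c 0) - K (c 0) (deriv c 0) (deriv c 0))
      = fderiv ℝ K (c 0) (deriv c 0) (deriv c 0) (deriv c 0)
        + 2 * K (c 0) (deriv (deriv c) 0) (deriv c 0) := by
  have h1 : HasDerivAt c (deriv c 0) 0 := (hc.differentiableAt (by norm_num)).hasDerivAt
  have hG' := hasDerivAt_bilin_velocity hG hGsymm hc
  have hK' := hasDerivAt_bilin_velocity hK hKsymm hc
  have hF' : HasDerivAt (fun t ↦ F (c t)) (fderiv ℝ F (c 0) (deriv c 0)) 0 :=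
    hF.hasFDerivAt.comp_hasDerivAt 0 h1
  -- Conservation of energy: pairing the geodesic equation with the velocity itself gives half the
  -- derivative of `G` along `c`, with a minus sign.
  have hzero : fderiv ℝ G (c 0) (deriv c 0) (deriv c 0) (deriv c 0)
        + 2 * G (c 0) (deriv (deriv c) 0) (deriv c 0) = 0 := by
    rw [hgeo, geodesicForce_apply]; ring
  rw [hzero] at hG'
  have hL := (hF'.exp.pow 2).mul (hG'.sub hK')
  have hR := (hG'.const_mul C).congr_of_eventuallyEq hC
  have := hL.unique hR
  have he : Real.exp (F (c 0)) ≠ 0 := (Real.exp_pos _).ne'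
  refine mul_left_cancel₀ (pow_ne_zero 2 he) ?_
  simp only [Nat.cast_ofNat, Pi.sub_apply, Pi.pow_apply] at this
  linear_combination this

/-- The derivative of `u ↦ K u a (ξ u)` in the direction `y`. -/
theorem fderiv_bilin_field {K : E → E →L[ℝ] E →L[ℝ] ℝ} {ξ : E → E} {x : E}
    (hK : DifferentiableAt ℝ K x) (hξ : DifferentiableAt ℝ ξ x) (a y : E) :
    fderiv ℝ (fun u ↦ K u a (ξ u)) x y = fderiv ℝ K x y a (ξ x) + K x a (fderiv ℝ ξ x y) := by
  rw [((hK.hasFDerivAt.clm_apply (hasFDerivAt_const a x)).clm_apply hξ.hasFDerivAt).fderiv]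
  simp [add_comm]

theorem fderiv_bilin_const {K : E → E →L[ℝ] E →L[ℝ] ℝ} {x : E}
    (hK : DifferentiableAt ℝ K x) (a b y : E) :
    fderiv ℝ (fun u ↦ K u a b) x y = fderiv ℝ K x y a b := by
  simpa using fderiv_bilin_field (ξ := fun _ ↦ b) hK (differentiableAt_const b) a y

/-- Polarised Clairaut relation in the direction of a vector field `ξ` on which the degenerate
form `K` agrees with `G`. -/
theorem clairaut_polarized {G K : E → E →L[ℝ] E →L[ℝ] ℝ} {ξ : E → E} {x v : E} {ℓ : E →L[ℝ] ℝ}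
    (hG : DifferentiableAt ℝ G x) (hK : DifferentiableAt ℝ K x) (hξ : DifferentiableAt ℝ ξ x)
    (hGsymm : ∀ u a b, G u a b = G u b a) (hKsymm : ∀ u a b, K u a b = K u b a)
    (hGK : ∀ᶠ u in 𝓝 x, ∀ a, K u a (ξ u) = G u a (ξ u))
    (hKnonneg : ∀ u a, 0 ≤ K u a a) (hKv : ∀ a, K x v a = 0) (hv : G x v v ≠ 0)
    (hrel : ∀ u, u ≠ 0 → ∃ a, (∀ w, G x a w = -geodesicForce G (x, u) w) ∧
      2 * ℓ u * (G x u u - K x u u) = fderiv ℝ K x u u u + 2 * K x a u) :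
    2 * ℓ (ξ x) * G x v v = fderiv ℝ G x (ξ x) v v + 2 * G x v (fderiv ℝ ξ x v) := by
  have hGs : ∀ y a b, fderiv ℝ G x y a b = fderiv ℝ G x y b a := fun y a b ↦ by
    rw [← fderiv_bilin_const hG, ← fderiv_bilin_const hG]; simp only [hGsymm _ a b]
  have hKs : ∀ y a b, fderiv ℝ K x y a b = fderiv ℝ K x y b a := fun y a b ↦ by
    rw [← fderiv_bilin_const hK, ← fderiv_bilin_const hK]; simp only [hKsymm _ a b]
  have hx : ∀ a, K x a (ξ x) = G x a (ξ x) := hGK.self_of_nhds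
  have hd : ∀ a y, fderiv ℝ K x y a (ξ x) + K x a (fderiv ℝ ξ x y)
      = fderiv ℝ G x y a (ξ x) + G x a (fderiv ℝ ξ x y) := fun a y ↦ by
    rw [← fderiv_bilin_field hK hξ, ← fderiv_bilin_field hG hξ]
    have h : (fun u ↦ K u a (ξ u)) =ᶠ[𝓝 x] fun u ↦ G u a (ξ u) := hGK.mono fun u hu ↦ hu a
    rw [h.fderiv_eq]
  -- With `v` frozen, `u ↦ K u v v` is nonnegative and vanishes at `x`, so `x` is a critical point.
  have hmin : ∀ y, fderiv ℝ K x y v v = 0 := fun y ↦ by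
    rw [← fderiv_bilin_const hK]
    have : IsLocalMin (fun u ↦ K u v v) x := Filter.Eventually.of_forall fun u ↦ by
      simpa [hKv] using hKnonneg u v
    simp [this.fderiv_eq_zero]
  have hGvξ : G x v (ξ x) = 0 := by rw [← hx, hKv]
  have hGξv : G x (ξ x) v = 0 := by rw [hGsymm, hGvξ]
  have hKva : ∀ a, K x a v = 0 := fun a ↦ by rw [hKsymm, hKv]
  have hne : ∀ s : ℝ, v + s • ξ x ≠ 0 := fun s h ↦ hv <| by
    have : G x v (v + s • ξ x) = 0 := by rw [h, map_zero]
    simpa [hGvξ] using this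
  -- The accelerations `a₁`, `a₂` enter only through `K(aᵢ, ξ) = G(aᵢ, ξ)`, because `K(aᵢ, v) = 0`;
  -- the geodesic equation then eliminates them.
  obtain ⟨a₁, ha₁, h₁⟩ := hrel _ (hne 1)
  obtain ⟨a₂, ha₂, h₂⟩ := hrel _ (hne (-1))
  have e1 := hx a₁
  have e2 := hx a₂
  rw [ha₁, geodesicForce_apply] at e1
  rw [ha₂, geodesicForce_apply] at e2
  have hξξ := hx (ξ x)
  have d1 := hd (ξ x) (ξ x)
  have d2 := hd v v
  have h3 : K x (ξ x) (fderiv ℝ ξ x (ξ x)) = G x (ξ x) (fderiv ℝ ξ x (ξ x)) := by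
    rw [hKsymm, hx, hGsymm]
  rw [hKv] at d2
  simp only [one_smul, neg_smul, map_add, map_neg, add_apply, neg_apply, hKva, hKv, hmin,
    hGvξ, hGξv, hξξ] at h₁ h₂ e1 e2 d1 d2 h3
  rw [hKs _ (ξ x) v] at h₁ h₂
  rw [hGs _ (ξ x) v] at e1 e2
  -- Half the difference keeps the part odd in `ξ`. The derivatives of `K` are traded for those of
  -- `G` by differentiating `K(a, ξ) = G(a, ξ)`, and the terms in `ξ` alone cancel.
  linear_combination (1 / 2) * h₁ - (1 / 2) * h₂ + e1 + e2 + 2 * d2 + d1 - h3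

/-! ### The Reeb field is Killing -/

/-- On a Sasakian manifold the Reeb field is an infinitesimal isometry, in coordinates. -/
theorem reeb_killing {G : E → E →L[ℝ] E →L[ℝ] ℝ} {φ : E → E →L[ℝ] E} {ξ : E → E}
    {η : E → E →L[ℝ] ℝ} {x : E}
    (hG : DifferentiableAt ℝ G x) (hφ : DifferentiableAt ℝ φ x) (hξ : DifferentiableAt ℝ ξ x)
    (hη : ContDiffAt ℝ 2 η x)
    (hφξ : ∀ᶠ u in 𝓝 x, φ u (ξ u) = 0) (hηξ : ∀ᶠ u in 𝓝 x, η u (ξ u) = 1)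
    (hηφ : ∀ᶠ u in 𝓝 x, ∀ a, η u (φ u a) = 0)
    (hφφ : ∀ a, φ x (φ x a) = -a + η x a • ξ x)
    (hcontact : ∀ᶠ u in 𝓝 x, ∀ a b,
      G u a (φ u b) = (1 / 2 : ℝ) * (fderiv ℝ η u a b - fderiv ℝ η u b a))
    (hnormal : ∀ a, φ x (φ x (fderiv ℝ ξ x a))
      = φ x (fderiv ℝ ξ x (φ x a) - fderiv ℝ φ x (ξ x) a)) (a b : E) :
    fderiv ℝ G x (ξ x) a (φ x b) + G x (fderiv ℝ ξ x a) (φ x b)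
      + G x a (fderiv ℝ ξ x (φ x b)) = 0 := by
  have hφξ0 := hφξ.self_of_nhds
  have hc0 := hcontact.self_of_nhds
  have hη1 : DifferentiableAt ℝ η x := hη.differentiableAt (by norm_num)
  have hη2 : DifferentiableAt ℝ (fderiv ℝ η) x :=
    (hη.fderiv_right (m := 1) (by norm_num)).differentiableAt (by norm_num)
  -- Symmetry of second derivatives, which carries the content of `d(dη) = 0`.
  have hsym : ∀ y a, fderiv ℝ (fderiv ℝ η) x y a = fderiv ℝ (fderiv ℝ η) x a y :=
    fun y a ↦ hη.isSymmSndFDerivAt (by simp) y a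
  have hskew : ∀ a b, G x a (φ x b) = -G x b (φ x a) := fun a b ↦ by rw [hc0, hc0]; ring
  -- The contraction of `dη` with `ξ` vanishes, since `φ ξ = 0`.
  have hdηξ : ∀ b, fderiv ℝ η x (ξ x) b = fderiv ℝ η x b (ξ x) := fun b ↦ by
    have := hc0 b (ξ x)
    rw [hφξ0, map_zero] at this
    linarith
  -- `d1` to `d4` differentiate the identities `η(ξ) = 1`, `η ∘ φ = 0`, `φ ξ = 0` and `G(a, φ b) =
  -- dη(a, b)`.
  have d1 : ∀ y, fderiv ℝ η x y (ξ x) + η x (fderiv ℝ ξ x y) = 0 := fun y ↦ by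
    have h := (hη1.hasFDerivAt.clm_apply hξ.hasFDerivAt).unique
      ((hasFDerivAt_const (1 : ℝ) x).congr_of_eventuallyEq hηξ)
    have := congrArg (· y) h
    simpa [add_comm] using this
  have d2 : ∀ y a, fderiv ℝ η x y (φ x a) + η x (fderiv ℝ φ x y a) = 0 := fun y a ↦ by
    have h := (hη1.hasFDerivAt.clm_apply
      (hφ.hasFDerivAt.clm_apply (hasFDerivAt_const a x))).unique
      ((hasFDerivAt_const (0 : ℝ) x).congr_of_eventuallyEq (hηφ.mono fun u hu ↦ hu a))
    have := congrArg (· y) h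
    simpa [add_comm] using this
  have d3 : ∀ y, fderiv ℝ φ x y (ξ x) + φ x (fderiv ℝ ξ x y) = 0 := fun y ↦ by
    have h := (hφ.hasFDerivAt.clm_apply hξ.hasFDerivAt).unique
      ((hasFDerivAt_const (0 : E) x).congr_of_eventuallyEq hφξ)
    have := congrArg (· y) h
    simpa [add_comm] using this
  have d4 : ∀ y a b, fderiv ℝ G x y a (φ x b) + G x a (fderiv ℝ φ x y b)
      = (1 / 2 : ℝ) * (fderiv ℝ (fderiv ℝ η) x y a b - fderiv ℝ (fderiv ℝ η) x y b a) :=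
    fun y a b ↦ by
    have hL := (hG.hasFDerivAt.clm_apply (hasFDerivAt_const a x)).clm_apply
      (hφ.hasFDerivAt.clm_apply (hasFDerivAt_const b x))
    have hR := (((hη2.hasFDerivAt.clm_apply (hasFDerivAt_const a x)).clm_apply
      (hasFDerivAt_const b x)).sub ((hη2.hasFDerivAt.clm_apply (hasFDerivAt_const b x)).clm_apply
      (hasFDerivAt_const a x))).const_mul (1 / 2 : ℝ)
    have h := hL.unique (hR.congr_of_eventuallyEq (hcontact.mono fun u hu ↦ hu a b))
    have := congrArg (· y) h
    simpa [add_comm] using this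
  -- This is `L_ξ φ = 0`. The defect `L` is killed by `φ` (normality) and by `η`, so `φ² = -I + η ⊗
  -- ξ` forces `L = 0`.
  have hlie : ∀ a, fderiv ℝ ξ x (φ x a) = fderiv ℝ φ x (ξ x) a + φ x (fderiv ℝ ξ x a) := by
    intro a
    set L := fderiv ℝ ξ x (φ x a) - fderiv ℝ φ x (ξ x) a - φ x (fderiv ℝ ξ x a) with hL
    have h0 : φ x L = 0 := by rw [hL, map_sub, hnormal a, sub_self]
    have h1 : η x L = 0 := by
      rw [hL, map_sub, map_sub, hηφ.self_of_nhds]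
      linarith [d1 (φ x a), d2 (ξ x) a, hdηξ (φ x a)]
    have h2 := hφφ L
    rw [h0, h1, map_zero, zero_smul, add_zero, eq_comm, neg_eq_zero] at h2
    rw [hL, sub_sub, sub_eq_zero] at h2
    exact h2
  -- The case `b = ξ` of `d4`, with the derivative of `φ` moved onto `ξ` by `d3`. After it only
  -- second derivatives of `η` remain, and these cancel by symmetry.
  have e1 : ∀ a y, G x a (φ x (fderiv ℝ ξ x y)) = -((1 / 2 : ℝ) *
      (fderiv ℝ (fderiv ℝ η) x y a (ξ x) - fderiv ℝ (fderiv ℝ η) x y (ξ x) a)) := fun a y ↦ by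
    rw [← d4, hφξ0, map_zero, zero_add, ← map_neg, neg_eq_of_add_eq_zero_right (d3 y)]
  rw [hlie, map_add, hskew (fderiv ℝ ξ x a) b, e1, e1]
  have h4 := d4 (ξ x) a b
  rw [hsym b (ξ x), hsym a (ξ x), hsym b a]
  linear_combination h4

end Calculus

/-! ### Pullbacks of Riemannian metrics to a vector space -/

section PullbackMetric

variable {E : Type*} [NormedAddCommGroup E] [NormedSpace ℝ E]
  {E' : Type*} [NormedAddCommGroup E'] [NormedSpace ℝ E']
  {X : Type*} [TopologicalSpace X] [ChartedSpace E' X] [IsManifold 𝓘(ℝ, E') ∞ X]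

theorem contMDiffOn_mfderiv_apply {F : E → X} {U : Set E} (hU : IsOpen U)
    (hF : ContMDiffOn 𝓘(ℝ, E) 𝓘(ℝ, E') ∞ F U) (a : E) :
    ContMDiffOn 𝓘(ℝ, E) 𝓘(ℝ, E').tangent ∞
      (fun u ↦ (TotalSpace.mk' E' (F u) (mfderiv 𝓘(ℝ, E) 𝓘(ℝ, E') F u a) :
        TangentBundle 𝓘(ℝ, E') X)) U := by
  have h1 := hF.contMDiffOn_tangentMapWithin (m := ∞) (by simp) hU.uniqueMDiffOn
  have h2 : ContMDiffOn 𝓘(ℝ, E) 𝓘(ℝ, E).tangent ∞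
      (fun u : E ↦ (TotalSpace.mk' E u a : TangentBundle 𝓘(ℝ, E) E)) U :=
    (contMDiffOn_vectorSpace_iff_contDiffOn (V := fun _ ↦ a)).2 contDiffOn_const
  refine (h1.comp h2 fun u hu ↦ hu).congr fun u hu ↦ ?_
  simp only [Function.comp_apply, tangentMapWithin, mfderivWithin_of_isOpen hU hu]

variable [RiemannianBundle (fun q : X ↦ TangentSpace 𝓘(ℝ, E') q)]

variable (E') in
/-- The pullback of a Riemannian metric under a map from a vector space. -/
def pullbackMetric (F : E → X) (u : E) : E →L[ℝ] E →L[ℝ] ℝ :=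
  let D : E →L[ℝ] TangentSpace 𝓘(ℝ, E') (F u) := mfderiv 𝓘(ℝ, E) 𝓘(ℝ, E') F u
  (innerSL ℝ).bilinearComp D D

theorem pullbackMetric_apply (F : E → X) (u a b : E) :
    pullbackMetric E' F u a b
      = inner ℝ (mfderiv 𝓘(ℝ, E) 𝓘(ℝ, E') F u a) (mfderiv 𝓘(ℝ, E) 𝓘(ℝ, E') F u b) := rfl

theorem pullbackMetric_symm (F : E → X) (u a b : E) :
    pullbackMetric E' F u a b = pullbackMetric E' F u b a := by
  rw [pullbackMetric_apply, pullbackMetric_apply, real_inner_comm]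

theorem pullbackMetric_nonneg (F : E → X) (u a : E) : 0 ≤ pullbackMetric E' F u a a := by
  rw [pullbackMetric_apply]; exact real_inner_self_nonneg

theorem contDiffOn_pullbackMetric [FiniteDimensional ℝ E]
    [IsContMDiffRiemannianBundle 𝓘(ℝ, E') ∞ E' (fun q : X ↦ TangentSpace 𝓘(ℝ, E') q)]
    {F : E → X} {U : Set E} (hU : IsOpen U) (hF : ContMDiffOn 𝓘(ℝ, E) 𝓘(ℝ, E') ∞ F U) :
    ContDiffOn ℝ ∞ (pullbackMetric E' F) U := by
  refine contDiffOn_clm_apply.2 fun a ↦ contDiffOn_clm_apply.2 fun b ↦ ?_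
  rw [← contMDiffOn_iff_contDiffOn]
  exact ContMDiffOn.inner_bundle (E := fun q : X ↦ TangentSpace 𝓘(ℝ, E') q) (b := F)
    (v := fun u ↦ mfderiv 𝓘(ℝ, E) 𝓘(ℝ, E') F u a) (w := fun u ↦ mfderiv 𝓘(ℝ, E) 𝓘(ℝ, E') F u b)
    (contMDiffOn_mfderiv_apply hU hF a) (contMDiffOn_mfderiv_apply hU hF b)

/-- A positive definite bilinear form on a finite-dimensional space is nondegenerate. -/
theorem isInvertible_of_posDef [FiniteDimensional ℝ E] (B : E →L[ℝ] E →L[ℝ] ℝ)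
    (hB : ∀ a, B a a = 0 → a = 0) : B.IsInvertible := by
  have hinj : Function.Injective (B : E →ₗ[ℝ] E →L[ℝ] ℝ) := by
    rw [← LinearMap.ker_eq_bot, LinearMap.ker_eq_bot']
    intro a ha
    have : B a = 0 := ha
    exact hB a (by rw [this]; rfl)
  have hrank : Module.finrank ℝ E = Module.finrank ℝ (E →L[ℝ] ℝ) := by
    rw [← (LinearMap.toContinuousLinearMap : (E →ₗ[ℝ] ℝ) ≃ₗ[ℝ] (E →L[ℝ] ℝ)).finrank_eq]
    exact Subspace.dual_finrank_eq.symm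
  refine ⟨(LinearEquiv.ofInjectiveOfFinrankEq (B : E →ₗ[ℝ] E →L[ℝ] ℝ) hinj
    hrank).toContinuousLinearEquiv, ?_⟩
  ext a b
  rfl

end PullbackMetric

/-! ### Vector fields, brackets and differentials in a chart -/

section Chart

variable {E : Type*} [NormedAddCommGroup E] [NormedSpace ℝ E]
  {M : Type*} [TopologicalSpace M] [ChartedSpace E M] [IsManifold 𝓘(ℝ, E) ∞ M]

/-- The coordinate frame at the point with coordinates `u` in the chart at `p`. -/
def chartFrame (p : M) (u : E) : E →L[ℝ] TangentSpace 𝓘(ℝ, E) ((extChartAt 𝓘(ℝ, E) p).symm u) :=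
  mfderiv 𝓘(ℝ, E) 𝓘(ℝ, E) (extChartAt 𝓘(ℝ, E) p).symm u

variable {p : M} {u : E}

theorem contMDiffAt_chart_symm (hu : u ∈ (extChartAt 𝓘(ℝ, E) p).target) :
    ContMDiffAt 𝓘(ℝ, E) 𝓘(ℝ, E) ∞ (extChartAt 𝓘(ℝ, E) p).symm u :=
  (contMDiffOn_extChartAt_symm p).contMDiffAt ((isOpen_extChartAt_target p).mem_nhds hu)

theorem mdifferentiableAt_chart_symm (hu : u ∈ (extChartAt 𝓘(ℝ, E) p).target) :
    MDifferentiableAt 𝓘(ℝ, E) 𝓘(ℝ, E) (extChartAt 𝓘(ℝ, E) p).symm u :=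
  (contMDiffAt_chart_symm hu).mdifferentiableAt (by simp)

theorem isInvertible_chartFrame (hu : u ∈ (extChartAt 𝓘(ℝ, E) p).target) :
    (chartFrame p u).IsInvertible := by
  have := isInvertible_mfderivWithin_extChartAt_symm (I := 𝓘(ℝ, E)) hu
  rwa [show range 𝓘(ℝ, E) = univ by simp, mfderivWithin_univ] at this

/-- The coordinate representation of a vector field in the chart at `p`. -/
def chartField (p : M) (X : VField E M) (u : E) : E :=
  (chartFrame p u).inverse (X ((extChartAt 𝓘(ℝ, E) p).symm u))

theorem chartFrame_chartField (hu : u ∈ (extChartAt 𝓘(ℝ, E) p).target) (X : VField E M) :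
    chartFrame p u (chartField p X u) = X ((extChartAt 𝓘(ℝ, E) p).symm u) :=
  (isInvertible_chartFrame hu).self_apply_inverse _

/-- The coordinate representation is the pullback of the field along the inverse chart, and pulling
back by a smooth map with invertible differential preserves smoothness. -/
theorem contDiffAt_chartField [CompleteSpace E] (hu : u ∈ (extChartAt 𝓘(ℝ, E) p).target)
    {X : VField E M}
    (hX : SmoothFieldAt X ((extChartAt 𝓘(ℝ, E) p).symm u)) :
    ContDiffAt ℝ ∞ (chartField p X) u :=
  (contMDiffAt_vectorSpace_iff_contDiffAt (V := chartField (E := E) p X)).1 <|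
    ContMDiffAt.mpullback_vectorField_preimage (n := ∞) hX (contMDiffAt_chart_symm hu)
      (isInvertible_chartFrame (E := E) hu) (by simp)

theorem SmoothFieldAt.mdifferentiableAt {X : VField E M} {q : M} (hX : SmoothFieldAt X q) :
    MDifferentiableAt 𝓘(ℝ, E) 𝓘(ℝ, E).tangent
      (fun q ↦ (TotalSpace.mk' E q (X q) : TangentBundle 𝓘(ℝ, E) M)) q :=
  ContMDiffAt.mdifferentiableAt hX (by simp)

/-- The Lie bracket in coordinates. -/
theorem mlieBracket_eq_chartFrame [CompleteSpace E]
    (hu : u ∈ (extChartAt 𝓘(ℝ, E) p).target) {X Y : VField E M}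
    (hX : SmoothFieldAt X ((extChartAt 𝓘(ℝ, E) p).symm u))
    (hY : SmoothFieldAt Y ((extChartAt 𝓘(ℝ, E) p).symm u)) :
    VectorField.mlieBracket 𝓘(ℝ, E) X Y ((extChartAt 𝓘(ℝ, E) p).symm u)
      = chartFrame p u (fderiv ℝ (chartField p Y) u (chartField p X u)
        - fderiv ℝ (chartField p X) u (chartField p Y u)) := by
  have : IsManifold 𝓘(ℝ, E) (minSmoothness ℝ 2) M := by
    rw [minSmoothness_of_isRCLikeNormedField]
    exact IsManifold.of_le (n := ∞) (WithTop.coe_le_coe.2 le_top)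
  have h := VectorField.mpullback_mlieBracket (n := ∞) hX.mdifferentiableAt hY.mdifferentiableAt
    (contMDiffAt_chart_symm hu)
    (by rw [minSmoothness_of_isRCLikeNormedField]; exact WithTop.coe_le_coe.2 le_top)
  rw [VectorField.mpullback_apply] at h
  rw [← (isInvertible_chartFrame hu).inverse_apply_eq]
  refine h.trans ?_
  rw [← VectorField.mlieBracketWithin_univ, VectorField.mlieBracketWithin_eq_lieBracketWithin]
  change VectorField.lieBracketWithin ℝ (chartField p X) (chartField p Y) univ u = _
  rw [VectorField.lieBracketWithin_univ, VectorField.lieBracket]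

/-- The vector field on the chart domain with constant coordinates `a`. -/
def coordField (p : M) (a : E) : VField E M :=
  VectorField.mpullback 𝓘(ℝ, E) 𝓘(ℝ, E) (extChartAt 𝓘(ℝ, E) p) (fun _ ↦ a)

theorem smoothFieldAt_coordField [CompleteSpace E]
    (hu : u ∈ (extChartAt 𝓘(ℝ, E) p).target) (a : E) :
    SmoothFieldAt (coordField p a) ((extChartAt 𝓘(ℝ, E) p).symm u) := by
  have hs := (extChartAt 𝓘(ℝ, E) p).map_target hu
  refine ContMDiffAt.mpullback_vectorField_preimage (n := ∞)
    ((contMDiffAt_vectorSpace_iff_contDiffAt (V := fun _ ↦ a)).2 contDiffAt_const)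
    (contMDiffAt_extChartAt' (by simpa using hs)) (isInvertible_mfderiv_extChartAt hs) (by simp)

theorem coordField_apply (hu : u ∈ (extChartAt 𝓘(ℝ, E) p).target) (a : E) :
    coordField p a ((extChartAt 𝓘(ℝ, E) p).symm u) = chartFrame p u a := by
  have hs := (extChartAt 𝓘(ℝ, E) p).map_target hu
  change (mfderiv 𝓘(ℝ, E) 𝓘(ℝ, E) (extChartAt 𝓘(ℝ, E) p)
    ((extChartAt 𝓘(ℝ, E) p).symm u)).inverse a = _
  refine (isInvertible_mfderiv_extChartAt hs).inverse_apply_eq.2 ?_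
  have := mfderiv_extChartAt_comp_mfderivWithin_extChartAt_symm (I := 𝓘(ℝ, E)) hu
  rw [show range 𝓘(ℝ, E) = univ by simp, mfderivWithin_univ] at this
  exact (congrArg (fun L : E →L[ℝ] E ↦ L a) this).symm

theorem chartField_coordField (hu : u ∈ (extChartAt 𝓘(ℝ, E) p).target) (a : E) :
    chartField p (coordField p a) u = a := by
  rw [chartField, coordField_apply hu, (isInvertible_chartFrame hu).inverse_apply_self]

theorem fderiv_chartField_coordField (hu : u ∈ (extChartAt 𝓘(ℝ, E) p).target) (a : E) :
    fderiv ℝ (chartField p (coordField p a)) u = 0 := by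
  have : chartField p (coordField p a) =ᶠ[𝓝 u] fun _ ↦ a :=
    Filter.eventuallyEq_of_mem ((isOpen_extChartAt_target p).mem_nhds hu)
      fun w hw ↦ chartField_coordField hw a
  rw [this.fderiv_eq]; simp

/-- The differential of a function in coordinates. -/
theorem differential_chartFrame (hu : u ∈ (extChartAt 𝓘(ℝ, E) p).target) {f : M → ℝ}
    (hf : MDifferentiableAt 𝓘(ℝ, E) 𝓘(ℝ, ℝ) f ((extChartAt 𝓘(ℝ, E) p).symm u)) (a : E) :
    differential f ((extChartAt 𝓘(ℝ, E) p).symm u) (chartFrame p u a)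
      = fderiv ℝ (fun w ↦ f ((extChartAt 𝓘(ℝ, E) p).symm w)) u a := by
  have h := mfderiv_comp u hf (mdifferentiableAt_chart_symm hu)
  rw [mfderiv_eq_fderiv] at h
  exact (congrArg (fun L : E →L[ℝ] ℝ ↦ L a) h).symm

theorem differentiableAt_chart (hu : u ∈ (extChartAt 𝓘(ℝ, E) p).target) {f : M → ℝ}
    (hf : MDifferentiableAt 𝓘(ℝ, E) 𝓘(ℝ, ℝ) f ((extChartAt 𝓘(ℝ, E) p).symm u)) :
    DifferentiableAt ℝ (fun w ↦ f ((extChartAt 𝓘(ℝ, E) p).symm w)) u :=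
  (hf.comp u (mdifferentiableAt_chart_symm hu)).differentiableAt

end Chart

/-! ### Sasakian structures in a chart -/

section Sasakian

variable {E : Type*} [NormedAddCommGroup E] [NormedSpace ℝ E] [FiniteDimensional ℝ E]
  {M : Type*} [TopologicalSpace M] [ChartedSpace E M] [IsManifold 𝓘(ℝ, E) ∞ M]
  [RiemannianBundle (fun p : M ↦ TangentSpace 𝓘(ℝ, E) p)]

namespace AlmostContactMetricStructure

variable (S : AlmostContactMetricStructure E M)

/-- Metric compatibility with `ξ` in the second slot, where `φ ξ = 0`. -/
theorem η_eq_inner {q : M} (v : TangentSpace 𝓘(ℝ, E) q) : S.η q v = inner ℝ v (S.ξ q) := by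
  have := S.inner_φ_φ q v (S.ξ q)
  rw [S.φ_ξ, S.η_ξ, inner_zero_right] at this
  linarith

/-- Compute `φ³ v` in two ways: they differ by `η(φ v) ξ`, and `η(ξ) = 1`. -/
theorem η_φ {q : M} (v : TangentSpace 𝓘(ℝ, E) q) : S.η q (S.φ q v) = 0 := by
  have := S.inner_φ_φ q (S.φ q v) (S.ξ q)
  have h2 := S.φ_φ q (S.φ q v)
  have h3 : S.φ q (S.φ q (S.φ q v)) = -S.φ q v := by
    rw [S.φ_φ q v, map_add, map_smul, S.φ_ξ, smul_zero, add_zero, map_neg]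
  rw [h3, left_eq_add] at h2
  have h4 := congrArg (S.η q) h2
  rwa [map_smul, S.η_ξ, smul_eq_mul, mul_one, map_zero] at h4

variable {S} {q : M} {X : VField E M}

theorem smoothFieldAt_ξ : SmoothFieldAt S.ξ q := S.smooth_ξ q

theorem smoothFieldAt_φ (hX : SmoothFieldAt X q) :
    SmoothFieldAt (fun r ↦ S.φ r (X r)) q :=
  ContMDiffAt.clm_bundle_apply (F₁ := E) (F₂ := E)
    (E₁ := fun r : M ↦ TangentSpace 𝓘(ℝ, E) r) (E₂ := fun r : M ↦ TangentSpace 𝓘(ℝ, E) r)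
    (b := fun r ↦ r) (S.smooth_φ q) hX

theorem contMDiffAt_η (hX : SmoothFieldAt X q) :
    ContMDiffAt 𝓘(ℝ, E) 𝓘(ℝ, ℝ) ∞ (fun r ↦ S.η r (X r)) q := by
  have := ContMDiffAt.clm_bundle_apply (F₁ := E) (F₂ := ℝ)
    (E₁ := fun r : M ↦ TangentSpace 𝓘(ℝ, E) r) (E₂ := Bundle.Trivial M ℝ)
    (b := fun r ↦ r) (S.smooth_η q) hX
  rw [contMDiffAt_totalSpace] at this
  exact this.2

variable (S) in
/-- The tensor field `φ` in the chart at `p`. -/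
def chartφ (p : M) (u : E) : E →L[ℝ] E :=
  (chartFrame p u).inverse ∘L S.φ ((extChartAt 𝓘(ℝ, E) p).symm u) ∘L chartFrame p u

variable (S) in
/-- The contact form in the chart at `p`. -/
def chartη (p : M) (u : E) : E →L[ℝ] ℝ :=
  (S.η ((extChartAt 𝓘(ℝ, E) p).symm u)).comp (chartFrame p u)

variable {p : M} {u : E}

theorem chartFrame_chartφ (hu : u ∈ (extChartAt 𝓘(ℝ, E) p).target) (a : E) :
    chartFrame p u (S.chartφ p u a)
      = S.φ ((extChartAt 𝓘(ℝ, E) p).symm u) (chartFrame p u a) :=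
  (isInvertible_chartFrame hu).self_apply_inverse _

theorem chartφ_apply (hu : u ∈ (extChartAt 𝓘(ℝ, E) p).target) (a : E) :
    chartField p (fun r ↦ S.φ r (coordField p a r)) u = S.chartφ p u a := by
  apply (isInvertible_chartFrame hu).injective
  rw [chartFrame_chartφ hu, chartFrame_chartField hu, coordField_apply hu]

theorem chartη_apply (hu : u ∈ (extChartAt 𝓘(ℝ, E) p).target) (a : E) :
    S.η ((extChartAt 𝓘(ℝ, E) p).symm u) (coordField p a ((extChartAt 𝓘(ℝ, E) p).symm u))
      = S.chartη p u a := by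
  rw [coordField_apply hu]; rfl

variable (S) in
theorem contDiffOn_chartφ (p : M) :
    ContDiffOn ℝ ∞ (S.chartφ p) (extChartAt 𝓘(ℝ, E) p).target := by
  have : CompleteSpace E := FiniteDimensional.complete ℝ E
  refine contDiffOn_clm_apply.2 fun a ↦ ?_
  exact ContDiffOn.congr (fun u hu ↦ (contDiffAt_chartField hu
    (smoothFieldAt_φ (smoothFieldAt_coordField hu a))).contDiffWithinAt)
    fun u hu ↦ (chartφ_apply hu a).symm

variable (S) in
theorem contDiffOn_chartη (p : M) :
    ContDiffOn ℝ ∞ (S.chartη p) (extChartAt 𝓘(ℝ, E) p).target := by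
  have : CompleteSpace E := FiniteDimensional.complete ℝ E
  refine contDiffOn_clm_apply.2 fun a ↦ ?_
  exact ContDiffOn.congr (fun u hu ↦ (((contMDiffAt_η (smoothFieldAt_coordField hu a)).comp u
    (contMDiffAt_chart_symm hu)).contDiffAt).contDiffWithinAt)
    fun u hu ↦ (chartη_apply hu a).symm

/-- The contact condition in coordinates. -/
theorem IsContact.chart (hS : S.IsContact) (hu : u ∈ (extChartAt 𝓘(ℝ, E) p).target) (a b : E) :
    pullbackMetric E (extChartAt 𝓘(ℝ, E) p).symm u a (S.chartφ p u b)
      = (1 / 2 : ℝ) * (fderiv ℝ (S.chartη p) u a b - fderiv ℝ (S.chartη p) u b a) := by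
  have : CompleteSpace E := FiniteDimensional.complete ℝ E
  have hX := smoothFieldAt_coordField hu a
  have hY := smoothFieldAt_coordField hu b
  have h := hS _ _ _ hX hY
  have hd : DifferentiableAt ℝ (S.chartη p) u :=
    ((S.contDiffOn_chartη p).contDiffAt ((isOpen_extChartAt_target p).mem_nhds hu)).differentiableAt
      (by simp)
  have hη : ∀ a b : E, differential (fun q ↦ S.η q (coordField p a q))
      ((extChartAt 𝓘(ℝ, E) p).symm u) (chartFrame p u b) = fderiv ℝ (S.chartη p) u b a := by
    intro a b
    rw [differential_chartFrame hu
      ((contMDiffAt_η (smoothFieldAt_coordField hu a)).mdifferentiableAt (by simp))]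
    have he : (fun w ↦ S.η ((extChartAt 𝓘(ℝ, E) p).symm w)
        (coordField p a ((extChartAt 𝓘(ℝ, E) p).symm w))) =ᶠ[𝓝 u] fun w ↦ S.chartη p w a :=
      Filter.eventuallyEq_of_mem ((isOpen_extChartAt_target p).mem_nhds hu)
        fun w hw ↦ chartη_apply hw a
    rw [he.fderiv_eq, (hd.hasFDerivAt.clm_apply (hasFDerivAt_const a u)).fderiv]
    simp
  rw [dOneForm, mlieBracket_eq_chartFrame hu hX hY, fderiv_chartField_coordField hu,
    fderiv_chartField_coordField hu, coordField_apply hu, coordField_apply hu, hη, hη,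
    zero_apply, zero_apply, sub_self, map_zero, map_zero, sub_zero] at h
  rw [pullbackMetric_apply]
  change inner ℝ (chartFrame p u a) (chartFrame p u (S.chartφ p u b)) = _
  rw [chartFrame_chartφ hu, h]

/-- The normality condition in coordinates, evaluated on the Reeb field. -/
theorem IsSasakian.chart_normal (hS : S.IsSasakian)
    (hu : u ∈ (extChartAt 𝓘(ℝ, E) p).target) (a : E) :
    S.chartφ p u (S.chartφ p u (fderiv ℝ (chartField p S.ξ) u a))
      = S.chartφ p u (fderiv ℝ (chartField p S.ξ) u (S.chartφ p u a)
        - fderiv ℝ (S.chartφ p) u (chartField p S.ξ u) a) := by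
  have : CompleteSpace E := FiniteDimensional.complete ℝ E
  have hX := smoothFieldAt_coordField hu a
  have hξ : SmoothFieldAt S.ξ ((extChartAt 𝓘(ℝ, E) p).symm u) := smoothFieldAt_ξ
  have hd : DifferentiableAt ℝ (S.chartφ p) u :=
    ((S.contDiffOn_chartφ p).contDiffAt ((isOpen_extChartAt_target p).mem_nhds hu)).differentiableAt
      (by simp)
  have h := hS.normal _ _ _ hX hξ
  have hzero : (fun q ↦ S.φ q (S.ξ q)) = (0 : VField E M) := funext S.φ_ξ
  have he : chartField p (fun r ↦ S.φ r (coordField p a r)) =ᶠ[𝓝 u] fun w ↦ S.chartφ p w a :=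
    Filter.eventuallyEq_of_mem ((isOpen_extChartAt_target p).mem_nhds hu)
      fun w hw ↦ chartφ_apply hw a
  -- With second argument `ξ`, `dη(X, ξ) = g(X, φ ξ) = 0` and the brackets with `φ ξ` drop out;
  -- normality becomes `φ²[X, ξ] = φ[φX, ξ]`.
  rw [← hS.contact _ _ _ hX hξ, S.φ_ξ, inner_zero_right, mul_zero, zero_smul, add_zero, nijenhuis,
    hzero, VectorField.mlieBracket_zero_right, VectorField.mlieBracket_zero_right,
    mlieBracket_eq_chartFrame hu hX hξ, mlieBracket_eq_chartFrame hu (smoothFieldAt_φ hX) hξ,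
    fderiv_chartField_coordField hu, chartField_coordField hu, chartφ_apply hu, he.fderiv_eq,
    (hd.hasFDerivAt.clm_apply (hasFDerivAt_const a u)).fderiv] at h
  simp only [Pi.zero_apply, map_zero, add_zero, sub_zero, sub_eq_zero, zero_apply] at h
  apply (isInvertible_chartFrame hu).injective
  rw [chartFrame_chartφ hu, chartFrame_chartφ hu, chartFrame_chartφ hu, h]
  simp

/-- The Reeb field of a Sasakian structure is a Killing field, in coordinates. -/
theorem IsSasakian.chart_killing
    [IsContMDiffRiemannianBundle 𝓘(ℝ, E) ∞ E (fun p : M ↦ TangentSpace 𝓘(ℝ, E) p)]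
    (hS : S.IsSasakian) (hu : u ∈ (extChartAt 𝓘(ℝ, E) p).target) (a b : E) :
    fderiv ℝ (pullbackMetric E (extChartAt 𝓘(ℝ, E) p).symm) u (chartField p S.ξ u) a
        (S.chartφ p u b)
      + pullbackMetric E (extChartAt 𝓘(ℝ, E) p).symm u (fderiv ℝ (chartField p S.ξ) u a)
        (S.chartφ p u b)
      + pullbackMetric E (extChartAt 𝓘(ℝ, E) p).symm u a
        (fderiv ℝ (chartField p S.ξ) u (S.chartφ p u b)) = 0 := by
  have : CompleteSpace E := FiniteDimensional.complete ℝ E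
  have hopen := isOpen_extChartAt_target (I := 𝓘(ℝ, E)) p
  have hnhds := hopen.mem_nhds hu
  have hG := (contDiffOn_pullbackMetric hopen (contMDiffOn_extChartAt_symm p)).contDiffAt hnhds
  have hη := (S.contDiffOn_chartη p).contDiffAt hnhds
  have hφξ : ∀ w ∈ (extChartAt 𝓘(ℝ, E) p).target, S.chartφ p w (chartField p S.ξ w) = 0 := by
    intro w hw
    apply (isInvertible_chartFrame hw).injective
    rw [chartFrame_chartφ hw, chartFrame_chartField hw, S.φ_ξ, map_zero]
  have hηξ : ∀ w ∈ (extChartAt 𝓘(ℝ, E) p).target, S.chartη p w (chartField p S.ξ w) = 1 := by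
    intro w hw
    change S.η _ (chartFrame p w (chartField p S.ξ w)) = 1
    rw [chartFrame_chartField hw, S.η_ξ]
  have hηφ : ∀ w ∈ (extChartAt 𝓘(ℝ, E) p).target, ∀ a, S.chartη p w (S.chartφ p w a) = 0 := by
    intro w hw a
    change S.η _ (chartFrame p w (S.chartφ p w a)) = 0
    rw [chartFrame_chartφ hw, S.η_φ]
  have hφφ : ∀ a, S.chartφ p u (S.chartφ p u a) = -a + S.chartη p u a • chartField p S.ξ u := by
    intro a
    apply (isInvertible_chartFrame hu).injective
    rw [chartFrame_chartφ hu, chartFrame_chartφ hu, S.φ_φ, map_add, map_neg, map_smul,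
      chartFrame_chartField hu]
    rfl
  exact reeb_killing (hG.differentiableAt (by simp))
    (((S.contDiffOn_chartφ p).contDiffAt hnhds).differentiableAt (by simp))
    ((contDiffAt_chartField hu smoothFieldAt_ξ).differentiableAt (by simp))
    (hη.of_le (WithTop.coe_le_coe.2 le_top))
    (Filter.eventually_of_mem hnhds hφξ) (Filter.eventually_of_mem hnhds hηξ)
    (Filter.eventually_of_mem hnhds hηφ) hφφ
    (Filter.eventually_of_mem hnhds fun w hw ↦ hS.contact.chart hw) (hS.chart_normal hu) a b

end AlmostContactMetricStructure

end Sasakian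

/-! ### Geodesics, the horizontal angle and Clairaut's relation in a chart -/

section Submersion

variable {E : Type*} [NormedAddCommGroup E] [NormedSpace ℝ E] [FiniteDimensional ℝ E]
  {M : Type*} [TopologicalSpace M] [ChartedSpace E M] [IsManifold 𝓘(ℝ, E) ∞ M]
  [RiemannianBundle (fun p : M ↦ TangentSpace 𝓘(ℝ, E) p)]
  {E' : Type*} [NormedAddCommGroup E'] [NormedSpace ℝ E'] [FiniteDimensional ℝ E']
  {N : Type*} [TopologicalSpace N] [ChartedSpace E' N] [IsManifold 𝓘(ℝ, E') ∞ N]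
  [RiemannianBundle (fun q : N ↦ TangentSpace 𝓘(ℝ, E') q)]

/-- A curve solving the geodesic equation in the chart at `p` is a geodesic. -/
theorem isGeodesicOn_of_chart
    [IsContMDiffRiemannianBundle 𝓘(ℝ, E) ∞ E (fun p : M ↦ TangentSpace 𝓘(ℝ, E) p)]
    {p : M} {c : ℝ → E} {s : Set ℝ} (hs : IsOpen s)
    (hmem : ∀ t ∈ s, c t ∈ (extChartAt 𝓘(ℝ, E) p).target) (hc : ∀ t ∈ s, ContDiffAt ℝ 2 c t)
    (hgeo : ∀ t ∈ s, ∀ w, pullbackMetric E (extChartAt 𝓘(ℝ, E) p).symm (c t) (deriv (deriv c) t) w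
      = -geodesicForce (pullbackMetric E (extChartAt 𝓘(ℝ, E) p).symm) (c t, deriv c t) w) :
    IsGeodesicOn (E := E) (fun t ↦ (extChartAt 𝓘(ℝ, E) p).symm (c t)) s := by
  refine ⟨fun t ht ↦ ?_, fun t ht ↦ ⟨p, (extChartAt 𝓘(ℝ, E) p).map_target (hmem t ht), ?_⟩⟩
  · exact ((contMDiffAt_chart_symm (hmem t ht)).continuousAt.comp
      (hc t ht).continuousAt).continuousWithinAt
  have he : chartCurve (E := E) p (fun t ↦ (extChartAt 𝓘(ℝ, E) p).symm (c t)) =ᶠ[𝓝 t] c :=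
    Filter.eventuallyEq_of_mem (hs.mem_nhds ht)
      fun r hr ↦ (extChartAt 𝓘(ℝ, E) p).right_inv (hmem r hr)
  refine ⟨(hc t ht).congr_of_eventuallyEq he, fun w ↦ ?_⟩
  have hG : DifferentiableAt ℝ (pullbackMetric E (extChartAt 𝓘(ℝ, E) p).symm) (c t) :=
    ((contDiffOn_pullbackMetric (isOpen_extChartAt_target p)
      (contMDiffOn_extChartAt_symm p)).contDiffAt
        ((isOpen_extChartAt_target p).mem_nhds (hmem t ht))).differentiableAt (by simp)
  have hf : ∀ a b y, fderiv ℝ (fun u' ↦ chartMetric p u' a b) (c t) y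
      = fderiv ℝ (pullbackMetric E (extChartAt 𝓘(ℝ, E) p).symm) (c t) y a b :=
    fun a b y ↦ fderiv_bilin_const hG a b y
  have hg := hgeo t ht w
  rw [geodesicForce_apply] at hg
  simp only [chartAcceleration, christoffel]
  -- Both lower arguments are `c'`, so the first two Christoffel terms coincide and the sum is
  -- `geodesicForce`.
  rw [he.eq_of_nhds, he.deriv_eq, he.deriv.deriv_eq, hf, hf]
  change pullbackMetric E (extChartAt 𝓘(ℝ, E) p).symm (c t) (deriv (deriv c) t) w + _ = 0
  rw [hg]
  ring

/-- The velocity of a curve in coordinates. -/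
theorem velocity_chart {p : M} {c : ℝ → E} {t : ℝ}
    (hmem : c t ∈ (extChartAt 𝓘(ℝ, E) p).target) (hc : DifferentiableAt ℝ c t) :
    velocity (E := E) (fun t ↦ (extChartAt 𝓘(ℝ, E) p).symm (c t)) t
      = chartFrame p (c t) (deriv c t) := by
  have h := mfderiv_comp t (mdifferentiableAt_chart_symm hmem) hc.mdifferentiableAt
  have h2 := congrArg (fun L : ℝ →L[ℝ] E ↦ L 1) h
  refine h2.trans ?_
  rw [mfderiv_eq_fderiv]
  rfl

variable {pr : M → N}

theorem mfderiv_starProjection_horizontal {q : M} (v : TangentSpace 𝓘(ℝ, E) q) :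
    mfderiv 𝓘(ℝ, E) 𝓘(ℝ, E') pr q ((horizontal E E' pr q).starProjection v)
      = mfderiv 𝓘(ℝ, E) 𝓘(ℝ, E') pr q v := by
  have h : v - (horizontal E E' pr q).starProjection v ∈ vertical E E' pr q := by
    have := (horizontal E E' pr q).sub_starProjection_mem_orthogonal v
    rwa [horizontal, Submodule.orthogonal_orthogonal] at this
  have h2 : mfderiv 𝓘(ℝ, E) 𝓘(ℝ, E') pr q
      (v - (horizontal E E' pr q).starProjection v) = 0 := h
  rw [map_sub, sub_eq_zero] at h2
  exact h2.symm

namespace IsRiemannianSubmersion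

/-- One horizontal argument suffices: neither side sees the vertical part of the other. With `w = ξ`
this is `K(·, ξ) = G(·, ξ)`. -/
theorem inner_mfderiv (hpr : IsRiemannianSubmersion E E' pr) {q : M}
    (v : TangentSpace 𝓘(ℝ, E) q) {w : TangentSpace 𝓘(ℝ, E) q}
    (hw : w ∈ horizontal E E' pr q) :
    inner ℝ (mfderiv 𝓘(ℝ, E) 𝓘(ℝ, E') pr q v) (mfderiv 𝓘(ℝ, E) 𝓘(ℝ, E') pr q w)
      = inner ℝ v w := by
  rw [← mfderiv_starProjection_horizontal v,
    hpr.isometric q _ (Submodule.starProjection_apply_mem _ _) w hw,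
    Submodule.inner_starProjection_left_eq_right, Submodule.starProjection_eq_self_iff.2 hw]

/-- `|v|² sin² θ = |v|² - |pr_* v|²` for the angle `θ` between `v` and the horizontal space. -/
theorem sin_sq_horizontalAngle (hpr : IsRiemannianSubmersion E E' pr) {q : M}
    (v : TangentSpace 𝓘(ℝ, E) q) :
    Real.sin (horizontalAngle E E' pr q v) ^ 2 * inner ℝ v v
      = inner ℝ v v - inner ℝ (mfderiv 𝓘(ℝ, E) 𝓘(ℝ, E') pr q v)
        (mfderiv 𝓘(ℝ, E) 𝓘(ℝ, E') pr q v) := by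
  set w := (horizontal E E' pr q).starProjection v with hw
  have hwm : w ∈ horizontal E E' pr q := Submodule.starProjection_apply_mem _ _
  have hpw : mfderiv 𝓘(ℝ, E) 𝓘(ℝ, E') pr q v = mfderiv 𝓘(ℝ, E) 𝓘(ℝ, E') pr q w :=
    (mfderiv_starProjection_horizontal v).symm
  have h1 : inner ℝ v w = inner ℝ w w := by
    rw [← hpr.inner_mfderiv v hwm, hpw, hpr.isometric q w hwm w hwm]
  have hcos := InnerProductGeometry.cos_angle_mul_norm_mul_norm v w
  rw [hpw, hpr.isometric q w hwm w hwm, Real.sin_sq, horizontalAngle, ← hw]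
  rw [h1, real_inner_self_eq_norm_sq] at hcos
  rw [real_inner_self_eq_norm_sq, real_inner_self_eq_norm_sq]
  -- For vertical `v` the angle to the zero vector is `π / 2` by convention, so the cosine is `0` as
  -- required.
  by_cases h0 : ‖w‖ = 0
  · rw [norm_eq_zero] at h0
    simp [h0]
  · have : Real.cos (InnerProductGeometry.angle v w) * ‖v‖ = ‖w‖ :=
      mul_right_cancel₀ h0 (by linear_combination hcos)
    rw [← this]; ring

/-- The pullback of the metric of the base in the chart at `p`, on a coordinate vector. -/
theorem pullbackMetric_comp_apply (hpr : IsRiemannianSubmersion E E' pr) {p : M} {u : E}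
    (hu : u ∈ (extChartAt 𝓘(ℝ, E) p).target) (a b : E) :
    pullbackMetric E' (pr ∘ (extChartAt 𝓘(ℝ, E) p).symm) u a b
      = inner ℝ (mfderiv 𝓘(ℝ, E) 𝓘(ℝ, E') pr _ (chartFrame p u a))
          (mfderiv 𝓘(ℝ, E) 𝓘(ℝ, E') pr _ (chartFrame p u b)) := by
  have h := mfderiv_comp u (hpr.smooth.contMDiffAt.mdifferentiableAt (by simp))
    (mdifferentiableAt_chart_symm (p := p) hu)
  rw [pullbackMetric_apply, h]
  rfl

end IsRiemannianSubmersion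

/-- The infinitesimal Clairaut relation in coordinates, for every initial velocity. -/
theorem IsClairautWith.chart
    [IsContMDiffRiemannianBundle 𝓘(ℝ, E) ∞ E (fun p : M ↦ TangentSpace 𝓘(ℝ, E) p)]
    [IsContMDiffRiemannianBundle 𝓘(ℝ, E') ∞ E' (fun q : N ↦ TangentSpace 𝓘(ℝ, E') q)]
    (hpr : IsRiemannianSubmersion E E' pr) {f : M → ℝ}
    (hf : MDifferentiable 𝓘(ℝ, E) 𝓘(ℝ, ℝ) f)
    (hcl : IsClairautWith E E' pr (fun p ↦ Real.exp (f p))) {p : M} {x : E}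
    (hx : x ∈ (extChartAt 𝓘(ℝ, E) p).target) {v : E} (hv : v ≠ 0) :
    ∃ a, (∀ w, pullbackMetric E (extChartAt 𝓘(ℝ, E) p).symm x a w
        = -geodesicForce (pullbackMetric E (extChartAt 𝓘(ℝ, E) p).symm) (x, v) w) ∧
      2 * fderiv ℝ (fun u ↦ f ((extChartAt 𝓘(ℝ, E) p).symm u)) x v
        * (pullbackMetric E (extChartAt 𝓘(ℝ, E) p).symm x v v
          - pullbackMetric E' (pr ∘ (extChartAt 𝓘(ℝ, E) p).symm) x v v)
      = fderiv ℝ (pullbackMetric E' (pr ∘ (extChartAt 𝓘(ℝ, E) p).symm)) x v v v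
        + 2 * pullbackMetric E' (pr ∘ (extChartAt 𝓘(ℝ, E) p).symm) x a v := by
  have : CompleteSpace E := FiniteDimensional.complete ℝ E
  have hopen := isOpen_extChartAt_target (I := 𝓘(ℝ, E)) p
  set F := (extChartAt 𝓘(ℝ, E) p).symm with hF
  have hFs : ContMDiffOn 𝓘(ℝ, E) 𝓘(ℝ, E) ∞ F (extChartAt 𝓘(ℝ, E) p).target :=
    contMDiffOn_extChartAt_symm p
  have hG := contDiffOn_pullbackMetric hopen hFs
  have hK := contDiffOn_pullbackMetric hopen (hpr.smooth.comp_contMDiffOn hFs)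
  have hinv : ∀ u ∈ (extChartAt 𝓘(ℝ, E) p).target, (pullbackMetric E F u).IsInvertible :=
    fun u hu ↦ isInvertible_of_posDef _ fun a ha ↦ by
      rw [pullbackMetric_apply, inner_self_eq_zero] at ha
      exact (isInvertible_chartFrame hu).injective (ha.trans (map_zero _).symm)
  -- The predicate `P` keeps the geodesic inside the chart and its velocity nonzero, as the Clairaut
  -- condition concerns regular geodesics only.
  obtain ⟨c, ε, hε, hc0, hd0, hc⟩ := exists_solution_second_order
    (contDiffAt_geodesicSpray (z := (x, v)) ((hG.contDiffAt (hopen.mem_nhds hx)).of_le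
      (WithTop.coe_le_coe.2 le_top)) (hinv x hx))
    (P := fun z ↦ z.1 ∈ (extChartAt 𝓘(ℝ, E) p).target ∧ z.2 ≠ 0)
    ((continuousAt_fst.eventually (hopen.mem_nhds hx)).and
      (continuousAt_snd.eventually_ne hv))
  have hgeo : ∀ t ∈ Ioo (-ε) ε, ∀ w, pullbackMetric E F (c t) (deriv (deriv c) t) w
      = -geodesicForce (pullbackMetric E F) (c t, deriv c t) w := fun t ht w ↦ by
    rw [(hc t ht).2.2]
    exact apply_geodesicSpray (z := (c t, deriv c t)) (hinv _ (hc t ht).1.1) w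
  have hvel : ∀ t ∈ Ioo (-ε) ε, velocity (E := E) (fun t ↦ F (c t)) t
      = chartFrame p (c t) (deriv c t) := fun t ht ↦
    velocity_chart (hc t ht).1.1 ((hc t ht).2.1.differentiableAt (by norm_num))
  obtain ⟨C, hC⟩ := hcl.2 (fun t ↦ F (c t)) (Ioo (-ε) ε) isOpen_Ioo ordConnected_Ioo
    (isGeodesicOn_of_chart isOpen_Ioo (fun t ht ↦ (hc t ht).1.1) (fun t ht ↦ (hc t ht).2.1) hgeo)
    (fun t ht h ↦ (hc t ht).1.2 <| (isInvertible_chartFrame (hc t ht).1.1).injective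
      ((hvel t ht).symm.trans (h.trans (map_zero _).symm)))
  have h0 : (0 : ℝ) ∈ Ioo (-ε) ε := ⟨by linarith, hε⟩
  have hx0 : c 0 ∈ (extChartAt 𝓘(ℝ, E) p).target := (hc 0 h0).1.1
  -- The constant is `C ^ 2`: the relation is squared and multiplied by `|c'|²`, which replaces the
  -- sine by a quadratic form in the velocity.
  have hmain := clairaut_derivative (G := pullbackMetric E F) (K := pullbackMetric E' (pr ∘ F))
    (F := fun u ↦ f (F u)) (c := c) (C := C ^ 2)
    ((hG.contDiffAt (hopen.mem_nhds hx0)).differentiableAt (by simp))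
    ((hK.contDiffAt (hopen.mem_nhds hx0)).differentiableAt (by simp))
    (differentiableAt_chart hx0 (hf _)) (pullbackMetric_symm F _) (pullbackMetric_symm _ _)
    (hc 0 h0).2.1 (hgeo 0 h0) (Filter.eventually_of_mem (isOpen_Ioo.mem_nhds h0) fun t ht ↦ by
      have hs := hpr.sin_sq_horizontalAngle (chartFrame p (c t) (deriv c t))
      have hCt := hC t ht
      rw [hvel t ht] at hCt
      rw [hpr.pullbackMetric_comp_apply (hc t ht).1.1]
      change _ * (inner ℝ (chartFrame p (c t) (deriv c t)) (chartFrame p (c t) (deriv c t)) - _)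
        = _ * inner ℝ (chartFrame p (c t) (deriv c t)) (chartFrame p (c t) (deriv c t))
      rw [← hs, ← hCt]
      ring)
  have hg0 := hgeo 0 h0
  rw [hc0, hd0] at hmain hg0
  exact ⟨_, hg0, hmain⟩

end Submersion

end ClairautSubmersion

end

/-! ### The Reeb field annihilates `f` -/

theorem mainTheorem5
    {E : Type*} [NormedAddCommGroup E] [NormedSpace ℝ E] [FiniteDimensional ℝ E]
    {M : Type*} [TopologicalSpace M] [T2Space M] [SecondCountableTopology M]
    [ChartedSpace E M] [IsManifold 𝓘(ℝ, E) ∞ M]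
    [RiemannianBundle (fun p : M ↦ TangentSpace 𝓘(ℝ, E) p)]
    [IsContMDiffRiemannianBundle 𝓘(ℝ, E) ∞ E (fun p : M ↦ TangentSpace 𝓘(ℝ, E) p)]
    {E' : Type*} [NormedAddCommGroup E'] [NormedSpace ℝ E'] [FiniteDimensional ℝ E']
    {N : Type*} [TopologicalSpace N] [T2Space N] [SecondCountableTopology N]
    [ChartedSpace E' N] [IsManifold 𝓘(ℝ, E') ∞ N]
    [RiemannianBundle (fun q : N ↦ TangentSpace 𝓘(ℝ, E') q)]
    [IsContMDiffRiemannianBundle 𝓘(ℝ, E') ∞ E' (fun q : N ↦ TangentSpace 𝓘(ℝ, E') q)]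
    (S : AlmostContactMetricStructure E M) (hS : S.IsSasakian)
    (pr : M → N) (hpr : IsRiemannianSubmersion E E' pr)
    (hanti : S.IsAntiInvariant E' pr) (hξ : S.HasHorizontalReeb E' pr)
    (f : M → ℝ) (hf : MDifferentiable 𝓘(ℝ, E) 𝓘(ℝ, ℝ) f)
    (hclairaut : IsClairautWith E E' pr (fun p ↦ Real.exp (f p))) (p : M) :
    inner ℝ (riemannianGradient f p) (S.ξ p) = 0 := by
  have : CompleteSpace E := FiniteDimensional.complete ℝ E
  have hopen := isOpen_extChartAt_target (I := 𝓘(ℝ, E)) p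
  set F := (extChartAt 𝓘(ℝ, E) p).symm with hF
  set x := extChartAt 𝓘(ℝ, E) p p with hxdef
  have hx : x ∈ (extChartAt 𝓘(ℝ, E) p).target := mem_extChartAt_target p
  -- The base point is replaced by `F x`, so that the tangent space is syntactically the one in
  -- which the chart lemmas live.
  suffices h : ∀ q, q = F x → inner ℝ (riemannianGradient f q) (S.ξ q) = 0 from
    h p (extChartAt_to_inv p).symm
  rintro _ rfl
  have hFs : ContMDiffOn 𝓘(ℝ, E) 𝓘(ℝ, E) ∞ F (extChartAt 𝓘(ℝ, E) p).target :=
    contMDiffOn_extChartAt_symm p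
  have hG := ((contDiffOn_pullbackMetric hopen hFs).contDiffAt
    (hopen.mem_nhds hx)).differentiableAt (by simp)
  have hK := ((contDiffOn_pullbackMetric hopen (hpr.smooth.comp_contMDiffOn hFs)).contDiffAt
    (hopen.mem_nhds hx)).differentiableAt (by simp)
  have hξd : DifferentiableAt ℝ (chartField p S.ξ) x :=
    (contDiffAt_chartField hx AlmostContactMetricStructure.smoothFieldAt_ξ).differentiableAt
      (by simp)
  obtain ⟨v, hv, hv0⟩ : ∃ v ∈ vertical E E' pr (F x), v ≠ 0 :=
    Submodule.exists_mem_ne_zero_of_ne_bot (LinearMap.ker_ne_bot_of_finrank_lt hpr.finrank_lt)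
  have hvker : mfderiv 𝓘(ℝ, E) 𝓘(ℝ, E') pr (F x) v = 0 := hv
  obtain ⟨a, rfl⟩ := (isInvertible_chartFrame hx).surjective v
  have hGa : pullbackMetric E F x a a ≠ 0 := fun h ↦ hv0 (inner_self_eq_zero.1 h)
  have hη : S.chartη p x a = 0 := by
    change S.η _ (chartFrame p x a) = 0
    rw [S.η_eq_inner]
    exact hξ _ _ hv
  have hpol := clairaut_polarized (K := pullbackMetric E' (pr ∘ F)) hG hK hξd
    (pullbackMetric_symm F) (pullbackMetric_symm _)
    (Filter.eventually_of_mem (hopen.mem_nhds hx) fun u hu b ↦ by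
      rw [hpr.pullbackMetric_comp_apply hu, chartFrame_chartField hu,
        hpr.inner_mfderiv _ (hξ _), ← chartFrame_chartField hu S.ξ]
      rfl)
    (pullbackMetric_nonneg _)
    (fun b ↦ by rw [hpr.pullbackMetric_comp_apply hx, hvker, inner_zero_left]) hGa
    (fun u hu ↦ hclairaut.chart hpr hf hx hu)
  -- The Killing equation is available for pairs `(a, φ b)`. As `η(a) = 0`, the choice `b = -φ a`
  -- gives `φ b = a`.
  have hkill := hS.chart_killing hx a (-S.chartφ p x a)
  have hφφ : S.chartφ p x (-S.chartφ p x a) = a := by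
    apply (isInvertible_chartFrame hx).injective
    rw [map_neg, map_neg, AlmostContactMetricStructure.chartFrame_chartφ hx,
      AlmostContactMetricStructure.chartFrame_chartφ hx, S.φ_φ]
    change -(-_ + S.chartη p x a • _) = _
    rw [hη, zero_smul, add_zero, neg_neg]
  rw [hφφ, pullbackMetric_symm _ _ _ a] at hkill
  have hzero : fderiv ℝ (fun u ↦ f (F u)) x (chartField p S.ξ x) = 0 := by
    have : fderiv ℝ (fun u ↦ f (F u)) x (chartField p S.ξ x) * pullbackMetric E F x a a = 0 := by
      -- `hpol` equates `2 df(ξ) G(a, a)` with `(L_ξ G)(a, a)`, and `hkill` says that the latter is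
      -- zero.
      linear_combination (1 / 2) * hpol + (1 / 2) * hkill
    exact (mul_eq_zero.1 this).resolve_right hGa
  rw [← differential_chartFrame hx (hf _), chartFrame_chartField hx] at hzero
  rw [riemannianGradient, InnerProductSpace.toDual_symm_apply]
  exact hzero
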